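/- Fix an alphabet (set) $\Sigma$ and a principal ideal domain $R$. **Precubical sets and HDAs.** A *precubical set* is a graded set $P=(P_n)_{n\ge 0}$ with face maps $d^k_i\colon P_n\to P_{n-1}$ ($n>0$, $k\in\{0,1\}$, $1\le i\le n$) such that $d^k_id^l_j=d^l_{j-1}d^k_i$ for $i<j$; morphisms are degree-preserving maps compatible with the face maps. A *higher-dimensional automaton* (HDA) over $\Sigma$ is a tuple $\mathcal Q=(P,\imath,F,\lambda)$ where $P$ is a precubical set, $\imath\in P_0$, $F\subseteq P_0$, and $\lambda\colon P_1\to\Sigma$ is a map with $\lambda(d^0_ix)=\lambda(d^1_ix)$ for all $x\in P_2$, $i\in\{1,2\}$. A morphism of HDAs is a morphism of precubical sets that preserves the initial state and the labels and maps final states to final states. $\mathcal Q'=(P',\imath',F',\lambda')$ is a *sub-HDA* of $\mathcal Q$ if $P'\subseteq P$ is stable under the face maps, $\imath'=\imath$, $F'=F\cap P'_0$ and $\lambda'=\lambda|_{P'_1}$. The *$1$-skeleton* $\mathcal Q_{\le 1}$ is the sub-HDA of cubes of degree $\le 1$. A *transition system* is an HDA without cubes of degree $\ge 2$ in which no two edges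 have the same label and the same start and end vertices. **HDA models.** Let $\mathcal T$ be a transition system and $\rho$ a relation on $\Sigma$. An HDA $\mathcal Q$ is an *HDA model of $\mathcal T$ with respect to $\rho$* if (HM1) $\mathcal Q_{\le 1}=\mathcal T$; (HM2) $\lambda(d^0_2x)\,\rho\,\lambda(d^0_1x)$ for every $2$-cube $x$; (HM3) for all $m\ge 2$, two $m$-cubes $x,y$ with $d^k_rx=d^k_ry$ for all $r,k$ are equal; (HM4) $\mathcal Q$ is not a proper sub-HDA of any HDA satisfying HM1–HM3. **Free symmetric HDA.** For $\theta\in S_n$ and $1\le i\le n$, let $d_i\theta\in S_{n-1}$ be obtained from $\theta$ by deleting the argument $\theta^{-1}(i)$ and the value $i$ and renumbering monotonically. The free symmetric HDA $S\mathcal Q$ generated by $\mathcal Q=(P,\imath,F,\lambda)$ has $n$-cubes $S_n\times P_n$, faces $d^k_i(\theta,x)=(d_i\theta,d^k_{\theta^{-1}(i)}x)$, initial state $(id,\imath)$, final states $S_0\times F$, labels $\mu(id,x)=\lambda(x)$, and the crossed action $\sigma\cdot(\theta,x)=(\sigma\theta,x)$. **Homology language.** Let $C_n(P)$ be the free $R$-module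 on $P_n$, with boundary $dx=\sum_{i=1}^n(-1)^i(d^0_ix-d^1_ix)$, and let $H_*(P)$ be its homology. Let $\Lambda(\Sigma)$ be the exterior algebra on the free $R$-module generated by $\Sigma$, graded by the exterior powers and with zero differential. The chain map $\mathfrak l\colon C_*(P)\to\Lambda(\Sigma)$ sends an $n$-cube $x$ to $\lambda(e_1x)\wedge\dots\wedge\lambda(e_nx)$ (to $1$ if $n=0$), where $e_ix=d^0_1\cdots d^0_{i-1}d^0_{i+1}\cdots d^0_nx$. The *homology language* of $\mathcal Q$ is the graded module $HL(\mathcal Q)=\operatorname{im}(\mathfrak l_*\colon H_*(P)\to\Lambda(\Sigma))$. **Theorem.** Let $\mathcal T$ be a transition system over $\Sigma$. Let $I$ be an independence relation on $\Sigma$ (that is, an irreflexive and symmetric relation) that is the symmetric closure of a relation $\ltimes$ which is acyclic: for all $n\ge 1$ and $x_1,\dots,x_n\in\Sigma$, if $x_1\ltimes x_2,\dots,x_{n-1}\ltimes x_n$, then $x_n\not\ltimes x_1$. Let $\mathcal A$ and $\mathcal Q$ be HDA models of $\mathcal T$ with respect to $I$ and $\ltimes$, respectively. Then $\mathcal A$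 is isomorphic, as an HDA, to the free symmetric HDA $S\mathcal Q$, and $HL(\mathcal A)=HL(\mathcal Q)$. -/

import Mathlib

open CategoryTheory

universe u v w

/-! ## Precubical sets

Cubes of degree `n + 1` have directions indexed by `Fin (n + 1)`, i.e. the direction called `i`
in the `1`-based convention is `i - 1` here. -/

/-- A precubical set: a graded set with face maps `d^k_i : P_{n+1} → P_n` satisfying the cubical
identities `d^k_i d^l_j = d^l_{j-1} d^k_i` for `i < j` (here `j.succ` plays the role of `j`). -/
structure PrecubicalSet where
  cube : ℕ → Type u
  face : {n : ℕ} → Fin 2 → Fin (n + 1) → cube (n + 1) → cube n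
  face_face : ∀ {n : ℕ} (k l : Fin 2) (i j : Fin (n + 1)), i ≤ j → ∀ x : cube (n + 2),
    face k i (face l j.succ x) = face l j (face k i.castSucc x)

namespace PrecubicalSet

/-- The cubical identities, for an arbitrary pair of directions. -/
theorem face_face_swap (P : PrecubicalSet.{u}) {n : ℕ} (k l : Fin 2) (i : Fin (n + 1))
    (j : Fin (n + 2)) (x : P.cube (n + 2)) :
    P.face k i (P.face l j x) = P.face l (i.predAbove j) (P.face k (j.succAbove i) x) := by
  rcases lt_or_ge i.castSucc j with h | h
  · obtain ⟨j, rfl⟩ := Fin.exists_succ_eq.2 (Fin.ne_zero_of_lt h)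
    rw [Fin.succAbove_of_castSucc_lt _ _ h, Fin.predAbove_of_castSucc_lt _ _ h, Fin.pred_succ]
    exact P.face_face k l i j (Fin.castSucc_lt_succ_iff.1 h) x
  · obtain ⟨j, rfl⟩ := Fin.exists_castSucc_eq.2 (Fin.ne_last_of_lt (h.trans_lt i.castSucc_lt_succ))
    rw [Fin.succAbove_of_le_castSucc _ _ h, Fin.predAbove_of_le_castSucc _ _ h,
      Fin.castPred_castSucc]
    exact (P.face_face l k j i (Fin.castSucc_le_castSucc_iff.1 h) x).symm

/-- The `i`-th starting edge `e_i x = d^0_1 ⋯ d^0_{i-1} d^0_{i+1} ⋯ d^0_n x` of a cube `x` of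
degree `n > 0`.  The rightmost face map is applied first: if `i` is not the last direction, one
first takes the last `0`-face and then the `i`-th starting edge; if `i` is the last direction, one
first takes the `0`-face in the last but one direction, and then the last starting edge. -/
def startEdge (P : PrecubicalSet.{u}) : {n : ℕ} → Fin (n + 1) → P.cube (n + 1) → P.cube 1
  | 0, _, x => x
  | n + 1, i, x =>
    Fin.lastCases (motive := fun _ => P.cube 1)
      (P.startEdge (Fin.last n) (P.face 0 (Fin.last n).castSucc x))
      (fun i => P.startEdge i (P.face 0 (Fin.last (n + 1)) x)) i

theorem exists_startEdge_eq (P : PrecubicalSet.{u}) {n : ℕ} (i : Fin (n + 2)) :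
    ∃ (a : Fin (n + 2)) (j : Fin (n + 1)), a.succAbove j = i ∧
      ∀ x : P.cube (n + 2), P.startEdge i x = P.startEdge j (P.face 0 a x) := by
  induction i using Fin.lastCases with
  | last =>
    refine ⟨(Fin.last n).castSucc, Fin.last n, ?_, fun x => ?_⟩
    · rw [Fin.succAbove_castSucc_self, Fin.succ_last]
    · rw [startEdge, Fin.lastCases_last]
  | cast i =>
    refine ⟨Fin.last (n + 1), i, Fin.succAbove_last_apply i, fun x => ?_⟩
    rw [startEdge, Fin.lastCases_castSucc]

/-- The `k`-skeleton `P_{≤ k}`, as a graded subset of `P`: all cubes of degree at most `k`. -/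
def skeleton (P : PrecubicalSet.{u}) (k n : ℕ) : Set (P.cube n) := {_x | n ≤ k}

/-- Morphisms of precubical sets. -/
@[ext]
structure Hom (P Q : PrecubicalSet.{u}) where
  app : (n : ℕ) → P.cube n → Q.cube n
  app_face : ∀ {n : ℕ} (k : Fin 2) (i : Fin (n + 1)) (x : P.cube (n + 1)),
    app n (P.face k i x) = Q.face k i (app (n + 1) x)

end PrecubicalSet

/-! ## The precubical set of permutations -/

/-- The face `d_i θ` of a permutation `θ`: delete the argument `θ⁻¹ i` and the value `i`, and
renumber the remaining arguments and values monotonically. -/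
def permFace {n : ℕ} (i : Fin (n + 1)) (θ : Equiv.Perm (Fin (n + 1))) : Equiv.Perm (Fin n) :=
  ((finSuccAboveEquiv (θ.symm i)).trans
    (θ.subtypeEquiv fun _ => not_congr (Equiv.eq_symm_apply θ))).trans (finSuccAboveEquiv i).symm

theorem succAbove_permFace {n : ℕ} (i : Fin (n + 1)) (θ : Equiv.Perm (Fin (n + 1))) (j : Fin n) :
    i.succAbove (permFace i θ j) = θ ((θ.symm i).succAbove j) := by
  have h : (finSuccAboveEquiv i (permFace i θ j)).1 = θ ((θ.symm i).succAbove j) := by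
    rw [permFace, Equiv.trans_apply, Equiv.apply_symm_apply]
    rfl
  rwa [finSuccAboveEquiv_apply] at h

theorem permFace_one {n : ℕ} (i : Fin (n + 1)) : permFace i (1 : Equiv.Perm (Fin (n + 1))) = 1 := by
  ext j : 1
  apply Fin.succAbove_right_injective (p := i)
  rw [succAbove_permFace]
  rfl

theorem permFace_mul {n : ℕ} (i : Fin (n + 1)) (σ θ : Equiv.Perm (Fin (n + 1))) :
    permFace i (σ * θ) = permFace i σ * permFace (σ.symm i) θ := by
  ext j : 1
  apply Fin.succAbove_right_injective (p := i)
  rw [Equiv.Perm.mul_apply, succAbove_permFace, succAbove_permFace, succAbove_permFace]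
  rfl

theorem succAbove_permFace_symm {n : ℕ} (i : Fin (n + 1)) (θ : Equiv.Perm (Fin (n + 1)))
    (j : Fin n) :
    (θ.symm i).succAbove ((permFace i θ).symm j) = θ.symm (i.succAbove j) := by
  rw [Equiv.eq_symm_apply, ← succAbove_permFace, Equiv.apply_symm_apply]

theorem predAbove_permFace_symm {n : ℕ} (i : Fin (n + 1)) (j : Fin (n + 2))
    (θ : Equiv.Perm (Fin (n + 2))) :
    ((permFace j θ).symm i).predAbove (θ.symm j) =
      (permFace (j.succAbove i) θ).symm (i.predAbove j) := by
  apply Fin.succAbove_right_injective (p := θ.symm (j.succAbove i))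
  rw [succAbove_permFace_symm, Fin.succAbove_succAbove_predAbove, ← succAbove_permFace_symm,
    Fin.succAbove_succAbove_predAbove]

theorem permFace_permFace {n : ℕ} (i : Fin (n + 1)) (j : Fin (n + 2))
    (θ : Equiv.Perm (Fin (n + 2))) :
    permFace i (permFace j θ) = permFace (i.predAbove j) (permFace (j.succAbove i) θ) := by
  ext m : 1
  apply Fin.succAbove_right_injective (p := i)
  apply Fin.succAbove_right_injective (p := j)
  conv_rhs => rw [← Fin.succAbove_succAbove_succAbove_predAbove]
  rw [succAbove_permFace, succAbove_permFace, succAbove_permFace, succAbove_permFace,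
    ← succAbove_permFace_symm, ← predAbove_permFace_symm,
    Fin.succAbove_succAbove_succAbove_predAbove]

/-! ## Symmetric precubical sets -/

/-- A crossed action of the precubical set of permutations on a precubical set. A symmetric
precubical set is a precubical set equipped with a crossed action. -/
structure CrossedAction (P : PrecubicalSet.{u}) where
  act : {n : ℕ} → Equiv.Perm (Fin n) → P.cube n → P.cube n
  one_act : ∀ {n : ℕ} (x : P.cube n), act 1 x = x
  mul_act : ∀ {n : ℕ} (σ θ : Equiv.Perm (Fin n)) (x : P.cube n),
    act (σ * θ) x = act σ (act θ x)
  face_act : ∀ {n : ℕ} (θ : Equiv.Perm (Fin (n + 1))) (x : P.cube (n + 1)) (k : Fin 2)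
    (i : Fin (n + 1)), P.face k i (act θ x) = act (permFace i θ) (P.face k (θ.symm i) x)

namespace PrecubicalSet

/-- The precubical set `SP` underlying the free symmetric precubical set generated by `P`. -/
def free (P : PrecubicalSet.{u}) : PrecubicalSet.{u} where
  cube n := Equiv.Perm (Fin n) × P.cube n
  face k i x := (permFace i x.1, P.face k (x.1.symm i) x.2)
  face_face := by
    rintro n k l i j hij ⟨θ, x⟩
    have h : i.castSucc < j.succ := Fin.castSucc_lt_succ_iff.2 hij
    have h1 : j.succ.succAbove i = i.castSucc := Fin.succAbove_of_castSucc_lt _ _ h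
    have h2 : i.predAbove j.succ = j := by
      rw [Fin.predAbove_of_castSucc_lt _ _ h, Fin.pred_succ]
    have e1 := permFace_permFace i j.succ θ
    have e2 := predAbove_permFace_symm i j.succ θ
    rw [h1, h2] at e1 e2
    refine Prod.ext e1 ?_
    change P.face k _ (P.face l _ x) = P.face l _ (P.face k _ x)
    rw [P.face_face_swap k l, e2, succAbove_permFace_symm, h1]

/-- The crossed action `σ · (θ, x) = (σ · θ, x)` on `SP`. -/
def freeAction (P : PrecubicalSet.{u}) : CrossedAction P.free where
  act σ x := (σ * x.1, x.2)
  one_act x := Prod.ext (one_mul x.1) rfl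
  mul_act σ θ x := Prod.ext (mul_assoc σ θ x.1) rfl
  face_act θ x _ i := Prod.ext (permFace_mul i θ x.1) rfl

end PrecubicalSet

/-! ## Higher-dimensional automata -/

/-- A higher-dimensional automaton over the alphabet `Sig`. -/
structure HDA (Sig : Type v) extends PrecubicalSet.{u} where
  init : cube 0
  final : Set (cube 0)
  label : cube 1 → Sig
  label_face : ∀ (x : cube 2) (i : Fin 2), label (face 0 i x) = label (face 1 i x)

namespace HDA

variable {Sig : Type v}

/-- Morphisms of HDAs. -/
@[ext]
structure Hom (A B : HDA.{u} Sig) extends A.toPrecubicalSet.Hom B.toPrecubicalSet where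
  app_init : app 0 A.init = B.init
  app_final : ∀ x ∈ A.final, app 0 x ∈ B.final
  label_app : ∀ x : A.cube 1, B.label (app 1 x) = A.label x

/-- The category of HDAs over `Sig`. -/
instance : Category (HDA.{u} Sig) where
  Hom := Hom
  id A :=
    { app := fun _ x => x
      app_face := fun _ _ _ => rfl
      app_init := rfl
      app_final := fun _ h => h
      label_app := fun _ => rfl }
  comp f g :=
    { app := fun n x => g.app n (f.app n x)
      app_face := fun k i x => by rw [f.app_face, g.app_face]
      app_init := by rw [f.app_init, g.app_init]
      app_final := fun x h => g.app_final _ (f.app_final x h)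
      label_app := fun x => by rw [g.label_app, f.label_app] }

/-- The `n`-th component of a morphism of HDAs. -/
abbrev mapCube {A B : HDA.{u} Sig} (f : A ⟶ B) (n : ℕ) : A.cube n → B.cube n :=
  PrecubicalSet.Hom.app (Hom.toHom f) n

/-- The morphism `f` is the inclusion of a sub-HDA (up to renaming cubes): it is injective, and
the final states of `A` are exactly the final states of `B` that lie in `A`. (As for any morphism,
the initial state and the labels of `A` are those of `B`.) -/
structure IsSubHDA {A B : HDA.{u} Sig} (f : A ⟶ B) : Prop where
  injective : ∀ n : ℕ, Function.Injective (mapCube f n)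
  final_iff : ∀ x : A.cube 0, mapCube f 0 x ∈ B.final ↔ x ∈ A.final

end HDA

/-- A symmetric HDA: an HDA equipped with a crossed action. -/
structure SymmetricHDA (Sig : Type v) extends HDA.{u} Sig where
  action : CrossedAction toPrecubicalSet

/-- The free symmetric HDA `SQ` generated by an HDA `Q`. As `id` is the only permutation in degree
`1`, the labelling is determined by `μ(id, x) = λ(x)`. -/
def HDA.freeSymmetric {Sig : Type v} (Q : HDA.{u} Sig) : SymmetricHDA.{u} Sig where
  toPrecubicalSet := Q.toPrecubicalSet.free
  init := (1, Q.init)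
  final := Set.univ ×ˢ Q.final
  label x := Q.label x.2
  label_face x i := Q.label_face x.2 (x.1.symm i)
  action := Q.toPrecubicalSet.freeAction

/-! ## Transition systems and HDA models -/

/-- A transition system is an HDA without cubes of degree `≥ 2` in which no two edges have the
same label and the same start and end vertices. -/
structure HDA.IsTransitionSystem {Sig : Type v} (T : HDA.{u} Sig) : Prop where
  truncated : ∀ n : ℕ, 2 ≤ n → IsEmpty (T.cube n)
  extensional : ∀ x y : T.cube 1, T.label x = T.label y →
    T.face 0 0 x = T.face 0 0 y → T.face 1 0 x = T.face 1 0 y → x = y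

/-- An independence relation: an irreflexive and symmetric relation on the alphabet. -/
structure IsIndependenceRelation {Sig : Type v} (I : Sig → Sig → Prop) : Prop where
  irrefl : ∀ a, ¬ I a a
  symm : ∀ a b, I a b → I b a

/-- A relation is acyclic if for all `n ≥ 1` and `x_1, …, x_n`, the relations
`x_1 r x_2, …, x_{n-1} r x_n` imply that `x_n r x_1` does not hold. -/
def IsAcyclicRelation {X : Type v} (r : X → X → Prop) : Prop :=
  ∀ (n : ℕ) (x : Fin (n + 1) → X), (∀ i : Fin n, r (x i.castSucc) (x i.succ)) →
    ¬ r (x (Fin.last n)) (x 0)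

namespace HDA

variable {Sig : Type v}

/-- HM1, relative to a given identification `j` of `T` with a sub-HDA of `Q`:
the sub-HDA `T` is the `1`-skeleton of `Q`. -/
structure HM1 {T Q : HDA.{u} Sig} (j : T ⟶ Q) : Prop where
  isSubHDA : IsSubHDA j
  range_eq : ∀ n : ℕ, Set.range (mapCube j n) = Q.skeleton 1 n

/-- HM2: the labels of the edges of each `2`-cube satisfy `λ(d^0_2 x) R λ(d^0_1 x)`. -/
def HM2 (Q : HDA.{u} Sig) (R : Sig → Sig → Prop) : Prop :=
  ∀ x : Q.cube 2, R (Q.label (Q.face 0 1 x)) (Q.label (Q.face 0 0 x))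

/-- HM3: in degrees `≥ 2`, cubes are determined by their faces. -/
def HM3 (Q : HDA.{u} Sig) : Prop :=
  ∀ (n : ℕ) (x y : Q.cube (n + 2)), (∀ k i, Q.face k i x = Q.face k i y) → x = y

/-- `Q` is an HDA model of `T` with respect to `R`: it satisfies HM1 - HM3, and HM4: it is not a
proper sub-HDA of any HDA `B` satisfying HM1 - HM3. In HM4, the inclusion of `Q` in `B` is
compatible with the identifications of `T` with the `1`-skeletons of `Q` and `B`. -/
def IsModelOf (Q T : HDA.{u} Sig) (R : Sig → Sig → Prop) : Prop :=
  ∃ j : T ⟶ Q, HM1 j ∧ Q.HM2 R ∧ Q.HM3 ∧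
    ∀ (B : HDA.{u} Sig) (j' : T ⟶ B), HM1 j' → B.HM2 R → B.HM3 →
      ∀ f : Q ⟶ B, IsSubHDA f → j ≫ f = j' → ∀ n : ℕ, Function.Surjective (mapCube f n)

end HDA

/-! ## Cubical homology -/

namespace PrecubicalSet

variable (R : Type w) [CommRing R] (P : PrecubicalSet.{u})

/-- The module of cubical `n`-chains: the free module on the `n`-cubes. -/
abbrev Chains (n : ℕ) : Type (max u w) := P.cube n →₀ R

/-- The boundary operator `d x = ∑ (-1)^i (d^0_i x - d^1_i x)`. As directions are numbered from `0`
here, the exponent is `i + 1`. -/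
noncomputable def boundary (n : ℕ) : P.Chains R (n + 1) →ₗ[R] P.Chains R n :=
  Finsupp.linearCombination R fun x => ∑ i : Fin (n + 1), (-1 : R) ^ ((i : ℕ) + 1) •
    (Finsupp.single (P.face 0 i x) (1 : R) - Finsupp.single (P.face 1 i x) (1 : R))

theorem boundary_single (n : ℕ) (x : P.cube (n + 1)) :
    P.boundary R n (Finsupp.single x 1) = ∑ i : Fin (n + 1), (-1 : R) ^ ((i : ℕ) + 1) •
      (Finsupp.single (P.face 0 i x) (1 : R) - Finsupp.single (P.face 1 i x) (1 : R)) := by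
  rw [boundary, Finsupp.linearCombination_single, one_smul]

theorem boundary_boundary (n : ℕ) (c : P.Chains R (n + 2)) :
    P.boundary R n (P.boundary R (n + 1) c) = 0 := by
  suffices h : (P.boundary R n).comp (P.boundary R (n + 1)) = 0 from LinearMap.congr_fun h c
  ext1 x
  apply LinearMap.ext_ring
  change P.boundary R n (P.boundary R (n + 1) (Finsupp.single x 1)) = 0
  rw [boundary_single]
  simp only [map_sum, map_smul, map_sub, boundary_single]
  simp only [← Finset.sum_sub_distrib, Finset.smul_sum, ← smul_sub, smul_smul]
  rw [← Fintype.sum_prod_type']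
  refine Finset.sum_involution (fun a _ => (a.1.succAbove a.2, a.2.predAbove a.1)) ?_ ?_ ?_ ?_
  · rintro ⟨j, i⟩ -
    have hs := Fin.neg_one_pow_succAbove_add_predAbove (R := R) j i
    simp only [P.face_face_swap _ _ i j]
    have e : (-1 : R) ^ ((j.succAbove i : ℕ) + 1) * (-1) ^ ((i.predAbove j : ℕ) + 1) =
        -((-1 : R) ^ ((j : ℕ) + 1) * (-1) ^ ((i : ℕ) + 1)) := by
      rw [← pow_add, ← pow_add, show (j.succAbove i : ℕ) + 1 + ((i.predAbove j : ℕ) + 1) =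
        ((j.succAbove i : ℕ) + (i.predAbove j : ℕ)) + 2 by ring,
        show (j : ℕ) + 1 + ((i : ℕ) + 1) = ((j : ℕ) + (i : ℕ)) + 2 by ring, pow_add _ _ 2, hs,
        pow_add _ ((j : ℕ) + (i : ℕ)) 2, neg_mul]
    rw [e, neg_smul, ← sub_eq_add_neg, ← smul_sub]
    convert smul_zero _
    abel
  · rintro ⟨j, i⟩ - - h
    exact Fin.succAbove_ne j i (congrArg Prod.fst h)
  · intros
    exact Finset.mem_univ _
  · rintro ⟨j, i⟩ -
    exact Prod.ext (Fin.succAbove_succAbove_predAbove j i) (Fin.predAbove_predAbove_succAbove j i)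

/-- The `n`-cycles of the nonnegative chain complex of cubical chains. -/
noncomputable def cycles : (n : ℕ) → Submodule R (P.Chains R n)
  | 0 => ⊤
  | n + 1 => LinearMap.ker (P.boundary R n)

theorem boundary_mem_cycles : ∀ (n : ℕ) (c : P.Chains R (n + 1)), P.boundary R n c ∈ P.cycles R n
  | 0, _ => Submodule.mem_top
  | n + 1, c => P.boundary_boundary R n c

/-- The `n`-boundaries, as a submodule of the module of `n`-cycles. -/
noncomputable def boundaries (n : ℕ) : Submodule R (P.cycles R n) :=
  LinearMap.range ((P.boundary R n).codRestrict (P.cycles R n) (P.boundary_mem_cycles R n))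

noncomputable instance (n : ℕ) : AddCommGroup (P.cycles R n) := Submodule.addCommGroup _

/-- The cubical homology `H_n(P)`: cycles modulo boundaries. -/
abbrev Homology (n : ℕ) : Type (max u w) := P.cycles R n ⧸ P.boundaries R n

end PrecubicalSet

/-! ## The homology language -/

namespace HDA

variable {Sig : Type v} (Q : HDA.{u} Sig)

/-- Parallel edges of a cube have the same label. -/
theorem label_startEdge_face : ∀ {n : ℕ} (k : Fin 2) (i : Fin (n + 2)) (j : Fin (n + 1))
    (x : Q.cube (n + 2)),
    Q.label (Q.startEdge j (Q.face k i x)) = Q.label (Q.startEdge (i.succAbove j) x) := by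
  intro n
  induction n with
  | zero =>
    intro k i j x
    obtain ⟨a, m, ham, h⟩ := Q.exists_startEdge_eq (i.succAbove j)
    have : Subsingleton (Fin (0 + 1)) := Fin.subsingleton_one
    obtain rfl : m = j := Subsingleton.elim _ _
    obtain rfl : a = i := Fin.succAbove_left_injective.eq_iff.1 (funext fun m' => by
      rwa [Subsingleton.elim m' m])
    rw [h]
    change Q.label (Q.face k a x) = Q.label (Q.face 0 a x)
    fin_cases k
    · rfl
    · exact (Q.label_face x a).symm
  | succ n ih =>
    intro k i j x
    obtain ⟨a, m, ham, h⟩ := Q.exists_startEdge_eq (i.succAbove j)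
    rw [h]
    by_cases hia : i = a
    · subst hia
      obtain rfl := Fin.succAbove_right_injective ham
      obtain ⟨b, l, -, hb⟩ := Q.exists_startEdge_eq m
      rw [hb, hb, Q.face_face_swap 0 k, Q.face_face_swap 0 0, ih, ih]
    · obtain ⟨i', rfl⟩ := Fin.exists_succAbove_eq hia
      have hne : m ≠ i' := by
        rintro rfl
        exact Fin.succAbove_ne _ _ ham.symm
      obtain ⟨l, rfl⟩ := Fin.exists_succAbove_eq hne
      have hj : (i'.predAbove a).succAbove l = j := by
        apply Fin.succAbove_right_injective (p := a.succAbove i')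
        rw [Fin.succAbove_succAbove_succAbove_predAbove, ham]
      rw [← ih k i' l, Q.face_face_swap k 0, ih, hj]

/-- The family of labels `λ(e_1 x), …, λ(e_n x)` of the starting edges of an `n`-cube (empty
if `n = 0`). -/
def edgeLabels : {n : ℕ} → Q.cube n → Fin n → Sig
  | 0, _, i => i.elim0
  | _ + 1, x, i => Q.label (Q.startEdge i x)

variable (R : Type w) [CommRing R]

/-- The labelling chain map `C_n(Q) → Λ^n(Σ)`, given on an `n`-cube `x` by
`λ(e_1 x) ∧ ⋯ ∧ λ(e_n x)`, which is `1` if `n = 0`. The exterior algebra on the free module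
generated by the alphabet is graded by the exterior powers. -/
noncomputable def labelling (n : ℕ) :
    Q.toPrecubicalSet.Chains R n →ₗ[R] ⋀[R]^n (Sig →₀ R) :=
  Finsupp.linearCombination R fun x =>
    exteriorPower.ιMulti R n fun i => Finsupp.single (Q.edgeLabels x i) (1 : R)

/-- The labelling is a chain map to the exterior algebra with zero differential. -/
theorem labelling_boundary (n : ℕ) (c : Q.toPrecubicalSet.Chains R (n + 1)) :
    Q.labelling R n (Q.toPrecubicalSet.boundary R n c) = 0 := by
  suffices h : (Q.labelling R n).comp (Q.toPrecubicalSet.boundary R n) = 0 from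
    LinearMap.congr_fun h c
  ext1 x
  apply LinearMap.ext_ring
  change Q.labelling R n (Q.toPrecubicalSet.boundary R n (Finsupp.single x 1)) = 0
  rw [PrecubicalSet.boundary_single]
  have key : ∀ i : Fin (n + 1), Q.edgeLabels (Q.face 0 i x) = Q.edgeLabels (Q.face 1 i x) := by
    intro i
    cases n with
    | zero => exact funext fun j => j.elim0
    | succ n =>
      funext j
      exact (Q.label_startEdge_face 0 i j x).trans (Q.label_startEdge_face 1 i j x).symm
  simp only [map_sum, map_smul, map_sub, labelling, Finsupp.linearCombination_single, one_smul,
    key, sub_self, smul_zero, Finset.sum_const_zero]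

/-- The map `H_n(Q) → H_n(Λ(Σ)) = Λ^n(Σ)` induced in homology by the labelling chain map. -/
noncomputable def labellingHomology (n : ℕ) :
    Q.toPrecubicalSet.Homology R n →ₗ[R] ⋀[R]^n (Sig →₀ R) :=
  (Q.toPrecubicalSet.boundaries R n).liftQ
    ((Q.labelling R n).comp (Q.toPrecubicalSet.cycles R n).subtype) (by
      rintro _ ⟨c, rfl⟩
      exact Q.labelling_boundary R n c)

/-- The homology language `HL(Q)`: the graded submodule of the exterior algebra on the alphabet
that is the image of the map induced in homology by the labelling chain map. -/
noncomputable def homologyLanguage (n : ℕ) : Submodule R (⋀[R]^n (Sig →₀ R)) :=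
  LinearMap.range (Q.labellingHomology R n)

end HDA

/-! Maximality of a model amounts to shell filling (`IsModelOf.fillsShells`): if a compatible family
of cubes with pairwise related labels bounded no cube, a new cube with that boundary could be
adjoined without violating HM1 - HM3. By HM3 the filler is unique. Cubes can therefore be
transported degree by degree from the 1-skeleton, and two HDAs with the same 1-skeleton that satisfy
HM2 and HM3 and fill shells are isomorphic (`HM1.nonempty_iso`).

It remains to see that `SQ` has these properties for the symmetric closure of `ltimes`. Here
acyclicity enters: `ltimes` is contained in a strict linear order, so the labels of a cube `x` of
`Q` are strictly increasing, and in a cube `(θ, x)` of `SQ` the permutation `θ` is the unique one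
that sorts the labels. Hence `θ` can be read off from the boundary, and HM3 and shell filling reduce
to those of `Q`.

For the homology languages, the inclusion `x ↦ (id, x)` and the signed projection `(θ, x) ↦ sign θ •
x` induce chain maps between `Q` and `SQ` that respect the labellings: the sign rule `sign_permFace`
matches the boundaries, and the wedge product is alternating. -/

/-! ### Acyclic relations, linear orders and sorting permutations. -/

/-- Turns the inductive closure into the finite sequences in terms of which acyclicity is phrased.
-/
theorem Relation.ReflTransGen.exists_fin_chain {X : Type v} {r : X → X → Prop} {a b : X}
    (h : Relation.ReflTransGen r a b) :
    ∃ (n : ℕ) (x : Fin (n + 1) → X), (∀ i : Fin n, r (x i.castSucc) (x i.succ)) ∧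
      x 0 = a ∧ x (Fin.last n) = b := by
  induction h with
  | refl => exact ⟨0, fun _ => a, fun i => i.elim0, rfl, rfl⟩
  | @tail c d _ hcd ih =>
    obtain ⟨n, x, hx, h0, hl⟩ := ih
    refine ⟨n + 1, Fin.snoc (α := fun _ => X) x d, fun i => ?_, ?_, Fin.snoc_last _ _⟩
    · induction i using Fin.lastCases with
      | last => rwa [Fin.succ_last, Fin.snoc_last, Fin.snoc_castSucc, hl]
      | cast i =>
        rw [Fin.succ_castSucc, Fin.snoc_castSucc, Fin.snoc_castSucc]
        exact hx i
    · rw [← Fin.castSucc_zero, Fin.snoc_castSucc, h0]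

/-- An acyclic relation is contained in a strict linear order. -/
theorem IsAcyclicRelation.exists_linearOrder {X : Type v} {r : X → X → Prop}
    (hr : IsAcyclicRelation r) : ∃ _ : LinearOrder X, ∀ a b, r a b → a < b := by
  -- A path from `a` to `b`, possibly of length zero, followed by `r b a` would be a cycle.
  have key : ∀ a b, Relation.ReflTransGen r a b → ¬ r b a := by
    intro a b h
    obtain ⟨n, x, hx, rfl, rfl⟩ := h.exists_fin_chain
    exact hr n x hx
  have : IsPartialOrder X (Relation.ReflTransGen r) :=
    { refl := fun _ => .refl
      trans := fun _ _ _ => .trans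
      antisymm := fun a b hab hba => by
        rcases hab.cases_tail with h | ⟨c, hac, hcb⟩
        · exact h.symm
        · exact absurd hcb (key b c (hba.trans hac)) }
  obtain ⟨s, hs, hrs⟩ := extend_partialOrder (Relation.ReflTransGen r)
  classical
  let _ : LinearOrder X :=
    { le := s
      le_refl := hs.refl
      le_trans := hs.trans
      le_antisymm := fun a b => hs.antisymm a b
      le_total := hs.total
      toDecidableLE := Classical.decRel _ }
  refine ⟨inferInstance, fun a b hab => lt_of_le_of_ne (hrs _ _ (.single hab)) ?_⟩
  rintro rfl
  exact key a a .refl hab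

/-- A permutation sorting an injective tuple into increasing order is unique. -/
theorem Equiv.Perm.eq_of_strictMono_comp {X : Type v} [LinearOrder X] {n : ℕ} {b : Fin n → X}
    {σ τ : Equiv.Perm (Fin n)} (hσ : StrictMono (b ∘ σ)) (hτ : StrictMono (b ∘ τ)) : σ = τ := by
  have hb : Function.Injective b := by
    rw [← σ.injective_comp]
    exact hσ.injective
  exact Equiv.ext fun i => hb (congrFun (Tuple.unique_monotone hσ.monotone hτ.monotone) i)

/-! ### Labels of the starting edges of a cube. -/

namespace HDA

variable {Sig : Type v}

theorem edgeLabels_face (Q : HDA.{u} Sig) {n : ℕ} (k : Fin 2) (i : Fin (n + 1)) (j : Fin n)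
    (x : Q.cube (n + 1)) : Q.edgeLabels (Q.face k i x) j = Q.edgeLabels x (i.succAbove j) := by
  cases n with
  | zero => exact j.elim0
  | succ n => exact Q.label_startEdge_face k i j x

theorem edgeLabels_one (Q : HDA.{u} Sig) (x : Q.cube 1) (i : Fin 1) :
    Q.edgeLabels x i = Q.label x := rfl

/-- The labels of the starting edges of a cube are pairwise related, in increasing order of the
directions. -/
theorem HM2.edgeLabels {Q : HDA.{u} Sig} {r : Sig → Sig → Prop} (hQ : Q.HM2 r) {n : ℕ}
    (x : Q.cube n) {i j : Fin n} (hij : i < j) : r (Q.edgeLabels x i) (Q.edgeLabels x j) := by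
  match n, x with
  | 0, _ => exact i.elim0
  | 1, _ => omega
  | 2, x =>
    obtain rfl : i = 0 := by omega
    obtain rfl : j = 1 := by omega
    have h := hQ x
    rw [← Q.edgeLabels_one _ 0, ← Q.edgeLabels_one _ 0, edgeLabels_face, edgeLabels_face] at h
    exact h
  | n + 3, x =>
    -- With at least three directions, a face in a third direction `m` keeps the directions `i` and
    -- `j` and their order; the recursion ends at HM2 itself.
    obtain ⟨m, hm⟩ : ∃ m : Fin (n + 3), m ∉ ({i, j} : Finset (Fin (n + 3))) := by
      by_contra! h
      have := (Finset.card_le_card fun m _ => h m : (Finset.univ : Finset (Fin (n + 3))).card ≤ _)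
      have h2 := Finset.card_le_two (a := i) (b := j)
      rw [Finset.card_univ, Fintype.card_fin] at this
      omega
    rw [Finset.mem_insert, Finset.mem_singleton, not_or] at hm
    obtain ⟨i, rfl⟩ := Fin.exists_succAbove_eq (Ne.symm hm.1)
    obtain ⟨j, rfl⟩ := Fin.exists_succAbove_eq (Ne.symm hm.2)
    rw [← edgeLabels_face (k := 0), ← edgeLabels_face (k := 0)]
    exact hQ.edgeLabels _ (Fin.succAbove_lt_succAbove_iff.1 hij)

theorem edgeLabels_mapCube {A B : HDA.{u} Sig} (f : A ⟶ B) {n : ℕ} (x : A.cube n) :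
    B.edgeLabels (mapCube f n x) = A.edgeLabels x := by
  induction n with
  | zero => exact funext fun i => i.elim0
  | succ n ih =>
    cases n with
    | zero => exact funext fun _ => f.label_app x
    | succ n =>
      funext i
      obtain ⟨a, j, rfl⟩ : ∃ (a : Fin (n + 2)) (j : Fin (n + 1)), a.succAbove j = i := by
        obtain ⟨a, ha⟩ := exists_ne i
        exact ⟨a, Fin.exists_succAbove_eq ha.symm⟩
      rw [← edgeLabels_face _ 0, ← edgeLabels_face _ 0, ← ih, ← f.app_face]

theorem mapCube_face {A B : HDA.{u} Sig} (f : A ⟶ B) {n : ℕ} (k : Fin 2) (i : Fin (n + 1))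
    (x : A.cube (n + 1)) : mapCube f n (A.face k i x) = B.face k i (mapCube f (n + 1) x) :=
  PrecubicalSet.Hom.app_face _ k i x

theorem HM1.exists_mapCube_eq {T A : HDA.{u} Sig} {j : T ⟶ A} (hj : HM1 j) {n : ℕ} (hn : n ≤ 1)
    (x : A.cube n) : ∃ t, mapCube j n t = x :=
  (hj.range_eq n).symm.subset hn

/-! ### Shells and their fillers in HDA models. -/

/-- A shell of degree `n + 2`: a compatible family of `(n + 1)`-cubes, parametrised like the faces
of an `(n + 2)`-cube, whose labels come from a tuple with pairwise related entries. -/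
structure IsShell (Q : HDA.{u} Sig) (r : Sig → Sig → Prop) {n : ℕ}
    (s : Fin 2 → Fin (n + 2) → Q.cube (n + 1)) (b : Fin (n + 2) → Sig) : Prop where
  face_face : ∀ (k l : Fin 2) (i : Fin (n + 1)) (j : Fin (n + 2)),
    Q.face k i (s l j) = Q.face l (i.predAbove j) (s k (j.succAbove i))
  edgeLabels : ∀ (k : Fin 2) (i : Fin (n + 2)) (j : Fin (n + 1)),
    Q.edgeLabels (s k i) j = b (i.succAbove j)
  rel : ∀ i j, i < j → r (b i) (b j)

/-- Every shell is the boundary of a cube. -/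
def FillsShells (Q : HDA.{u} Sig) (r : Sig → Sig → Prop) : Prop :=
  ∀ (n : ℕ) (s : Fin 2 → Fin (n + 2) → Q.cube (n + 1)) (b : Fin (n + 2) → Sig),
    Q.IsShell r s b → ∃ x, ∀ k i, Q.face k i x = s k i

section Adjunction

/-- The cubes of a graded set together with one additional cube of degree `n + 2`. -/
inductive AdjoinCube (C : ℕ → Type u) (n : ℕ) : ℕ → Type u
  | old {m : ℕ} (x : C m) : AdjoinCube C n m
  | new : AdjoinCube C n (n + 2)

theorem AdjoinCube.old_injective {C : ℕ → Type u} {n m : ℕ} :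
    Function.Injective (AdjoinCube.old : C m → AdjoinCube C n m) := by
  intro x y h
  cases h
  rfl

/-- The faces of the old cubes and, according to `s`, of the new cube. -/
def adjoinFace (Q : HDA.{u} Sig) {n : ℕ} (s : Fin 2 → Fin (n + 2) → Q.cube (n + 1)) (k : Fin 2) :
    {m : ℕ} → Fin (m + 1) → AdjoinCube Q.cube n (m + 1) → AdjoinCube Q.cube n m
  | _, i, .old x => .old (Q.face k i x)
  | _, i, .new => .old (s k i)

/-- The label of an edge. -/
def adjoinLabel (Q : HDA.{u} Sig) (n : ℕ) : AdjoinCube Q.cube n 1 → Sig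
  | .old x => Q.label x

/-- The HDA obtained from `Q` by filling a shell with a new cube. -/
def adjoin (Q : HDA.{u} Sig) {r : Sig → Sig → Prop} {n : ℕ}
    {s : Fin 2 → Fin (n + 2) → Q.cube (n + 1)} {b : Fin (n + 2) → Sig} (hs : Q.IsShell r s b) :
    HDA.{u} Sig where
  cube := AdjoinCube Q.cube n
  face k i x := Q.adjoinFace s k i x
  face_face {m} k l i j hij x := by
    have h : i.castSucc < j.succ := Fin.castSucc_lt_succ_iff.2 hij
    cases x with
    | old x => exact congrArg AdjoinCube.old (Q.face_face k l i j hij x)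
    | new =>
      refine congrArg AdjoinCube.old ((hs.face_face k l i j.succ).trans ?_)
      rw [Fin.succAbove_of_castSucc_lt _ _ h, Fin.predAbove_of_castSucc_lt _ _ h, Fin.pred_succ]
  init := .old Q.init
  final := AdjoinCube.old '' Q.final
  label := Q.adjoinLabel n
  label_face x i := by
    cases x with
    | old x => exact Q.label_face x i
    | new => exact (hs.edgeLabels 0 i 0).trans (hs.edgeLabels 1 i 0).symm

/-- The inclusion of an HDA in the one obtained by filling a shell. -/
def adjoinInclusion (Q : HDA.{u} Sig) {r : Sig → Sig → Prop} {n : ℕ}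
    {s : Fin 2 → Fin (n + 2) → Q.cube (n + 1)} {b : Fin (n + 2) → Sig} (hs : Q.IsShell r s b) :
    Q ⟶ Q.adjoin hs :=
  show HDA.Hom _ _ from
  { app := fun _ x => .old x
    app_face := fun _ _ _ => rfl
    app_init := rfl
    app_final := fun x hx => ⟨x, hx, rfl⟩
    label_app := fun _ => rfl }

end Adjunction

theorem IsSubHDA.comp {A B C : HDA.{u} Sig} {f : A ⟶ B} {g : B ⟶ C} (hf : IsSubHDA f)
    (hg : IsSubHDA g) : IsSubHDA (f ≫ g) where
  injective n := (hg.injective n).comp (hf.injective n)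
  final_iff x := (hg.final_iff _).trans (hf.final_iff x)

/-- An HDA model fills shells, since a shell without filler could be filled by a new cube. -/
theorem IsModelOf.fillsShells {Q T : HDA.{u} Sig} {r : Sig → Sig → Prop} (hQ : Q.IsModelOf T r) :
    Q.FillsShells r := by
  obtain ⟨j, hj, h2, h3, h4⟩ := hQ
  intro n s b hs
  by_contra! hno
  have hsub : IsSubHDA (Q.adjoinInclusion hs) :=
    { injective := fun _ => AdjoinCube.old_injective
      final_iff := fun x => AdjoinCube.old_injective.mem_set_image }
  have hm1 : HM1 (j ≫ Q.adjoinInclusion hs) :=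
    { isSubHDA := hj.isSubHDA.comp hsub
      range_eq := fun m => by
        ext x
        constructor
        · rintro ⟨t, rfl⟩
          exact (hj.range_eq m).subset ⟨t, rfl⟩
        -- The new cube has degree at least 2, so the 1-skeleton is unchanged.
        · intro (hx : m ≤ 1)
          cases x with
          | old x =>
            obtain ⟨t, rfl⟩ := hj.exists_mapCube_eq hx x
            exact ⟨t, rfl⟩
          | new => omega }
  have hm2 : (Q.adjoin hs).HM2 r := by
    intro x
    cases x with
    | old x => exact h2 x
    | new =>
      -- The new cube is a 2-cube only for `n = 0`; its faces `s 0 1` and `s 0 0` then carry the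
      -- labels `b 0` and `b 1`.
      have e0 := hs.edgeLabels 0 0 0
      have e1 := hs.edgeLabels 0 1 0
      rw [edgeLabels_one] at e0 e1
      change r (Q.label (s 0 1)) (Q.label (s 0 0))
      rw [e0, e1]
      exact hs.rel 0 1 (by decide)
  have hm3 : (Q.adjoin hs).HM3 := by
    intro m x y hxy
    cases x with
    | old x =>
      cases y with
      | old y =>
        exact congrArg _ (h3 m x y fun k i => AdjoinCube.old_injective (hxy k i))
      | new =>
        -- An old cube with the boundary of the new one would already have filled the shell.
        obtain ⟨k, i, h⟩ := hno x
        exact absurd (AdjoinCube.old_injective (hxy k i)) h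
    | new =>
      cases y with
      | old y =>
        obtain ⟨k, i, h⟩ := hno y
        exact absurd (AdjoinCube.old_injective (hxy k i)).symm h
      | new => rfl
  obtain ⟨x, hx⟩ := h4 _ _ hm1 hm2 hm3 _ hsub rfl (n + 2) AdjoinCube.new
  cases hx

/-! ### Extension of morphisms from the 1-skeleton. -/

section Extension

variable {T A B : HDA.{u} Sig}

/-- The cubes `x` of `A` and `y` of `B` correspond to each other if they come from the same cube of
`T` in degrees at most `1`, and if their faces correspond to each other in degrees at least `2`. -/
def Corresponds (j : T ⟶ A) (j' : T ⟶ B) : (n : ℕ) → A.cube n → B.cube n → Prop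
  | 0, x, y => ∃ t, mapCube j 0 t = x ∧ mapCube j' 0 t = y
  | 1, x, y => ∃ t, mapCube j 1 t = x ∧ mapCube j' 1 t = y
  | n + 2, x, y => ∀ k i, Corresponds j j' (n + 1) (A.face k i x) (B.face k i y)

theorem Corresponds.face {j : T ⟶ A} {j' : T ⟶ B} : ∀ {n : ℕ} {x : A.cube (n + 1)}
    {y : B.cube (n + 1)}, Corresponds j j' (n + 1) x y → ∀ k i,
      Corresponds j j' n (A.face k i x) (B.face k i y)
  | 0, _, _, ⟨t, hx, hy⟩, k, i => ⟨T.face k i t, by rw [← hx, mapCube_face], by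
      rw [← hy, mapCube_face]⟩
  | _ + 1, _, _, h, k, i => h k i

theorem Corresponds.edgeLabels {j : T ⟶ A} {j' : T ⟶ B} {n : ℕ} {x : A.cube n} {y : B.cube n}
    (h : Corresponds j j' n x y) : A.edgeLabels x = B.edgeLabels y := by
  induction n with
  | zero => exact funext fun i => i.elim0
  | succ n ih =>
    cases n with
    | zero =>
      obtain ⟨t, rfl, rfl⟩ := h
      rw [edgeLabels_mapCube, edgeLabels_mapCube]
    | succ n =>
      funext i
      obtain ⟨a, ha⟩ := exists_ne i
      obtain ⟨m, rfl⟩ := Fin.exists_succAbove_eq ha.symm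
      rw [← edgeLabels_face _ 0, ← edgeLabels_face _ 0, ih (h 0 a)]

theorem Corresponds.unique {j : T ⟶ A} {j' : T ⟶ B} (hj : HM1 j) (hB : B.HM3) :
    ∀ {n : ℕ} {x : A.cube n} {y y' : B.cube n}, Corresponds j j' n x y →
      Corresponds j j' n x y' → y = y'
  | 0, _, _, _, ⟨t, hx, hy⟩, ⟨t', hx', hy'⟩ => by
    rw [← hy, ← hy', hj.isSubHDA.injective 0 (hx.trans hx'.symm)]
  | 1, _, _, _, ⟨t, hx, hy⟩, ⟨t', hx', hy'⟩ => by
    rw [← hy, ← hy', hj.isSubHDA.injective 1 (hx.trans hx'.symm)]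
  | n + 2, _, _, _, h, h' => hB n _ _ fun k i => (h k i).unique hj hB (h' k i)

/-- The cubes of `B` corresponding to the faces of `x` form a shell with the labels of `x`; any
filler corresponds to `x`. -/
theorem Corresponds.exists {r : Sig → Sig → Prop} {j : T ⟶ A} (j' : T ⟶ B) (hj : HM1 j)
    (hA : A.HM2 r) (hB : B.HM3) (hfill : B.FillsShells r) :
    ∀ {n : ℕ} (x : A.cube n), ∃ y, Corresponds j j' n x y
  | 0, x => by
    obtain ⟨t, ht⟩ := hj.exists_mapCube_eq zero_le_one x
    exact ⟨_, t, ht, rfl⟩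
  | 1, x => by
    obtain ⟨t, ht⟩ := hj.exists_mapCube_eq le_rfl x
    exact ⟨_, t, ht, rfl⟩
  | n + 2, x => by
    choose s hs using fun k i => Corresponds.exists j' hj hA hB hfill (A.face k i x)
    obtain ⟨y, hy⟩ := hfill n s (A.edgeLabels x)
      -- Both sides correspond to the same iterated face of `x`, so they agree by uniqueness.
      { face_face := fun k l i m => by
          refine ((hs l m).face k i).unique hj hB ?_
          rw [A.face_face_swap]
          exact (hs k (m.succAbove i)).face l (i.predAbove m)
        edgeLabels := fun k i m => by rw [← (hs k i).edgeLabels, edgeLabels_face]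
        rel := fun _ _ h => hA.edgeLabels x h }
    exact ⟨y, fun k i => hy k i ▸ hs k i⟩

/-- A morphism on the `1`-skeleton extends to HDAs in which shells have a unique filler. -/
theorem HM1.exists_extension {r : Sig → Sig → Prop} {j : T ⟶ A} (j' : T ⟶ B) (hj : HM1 j)
    (hA : A.HM2 r) (hB : B.HM3) (hfill : B.FillsShells r) : ∃ f : A ⟶ B, j ≫ f = j' := by
  choose f hf using fun (n : ℕ) (x : A.cube n) => Corresponds.exists j' hj hA hB hfill x
  have hfj : ∀ n t, n ≤ 1 → f n (mapCube j n t) = mapCube j' n t := by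
    intro n t hn
    refine (hf n _).unique hj hB ?_
    interval_cases n
    · exact ⟨t, rfl, rfl⟩
    · exact ⟨t, rfl, rfl⟩
  refine ⟨show HDA.Hom A B from
    { app := f
      app_face := fun k i x => (hf _ _).unique hj hB ((hf _ x).face k i)
      app_init := ?_
      app_final := fun x hx => ?_
      label_app := fun x => (congrFun (hf 1 x).edgeLabels 0).symm }, ?_⟩
  · rw [← j.app_init, ← j'.app_init]
    exact hfj 0 _ zero_le_one
  · obtain ⟨t, rfl⟩ := hj.exists_mapCube_eq zero_le_one x
    rw [hfj 0 t zero_le_one]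
    exact j'.app_final _ ((hj.isSubHDA.final_iff t).1 hx)
  · refine HDA.Hom.ext (funext fun n => funext fun t => hfj n t ?_)
    -- The image of `T` is the 1-skeleton of `A`, so a cube `t` has degree at most 1.
    exact (hj.range_eq n).subset ⟨t, rfl⟩

/-- A morphism to an HDA satisfying HM3 is determined by its restriction to the `1`-skeleton. -/
theorem HM1.hom_ext {j : T ⟶ A} (hj : HM1 j) (hB : B.HM3) {f g : A ⟶ B} (h : j ≫ f = j ≫ g) :
    f = g := by
  suffices H : ∀ n (x : A.cube n), mapCube f n x = mapCube g n x from
    HDA.Hom.ext (funext fun n => funext fun x => H n x)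
  have hlow : ∀ n (x : A.cube n), n ≤ 1 → mapCube f n x = mapCube g n x := by
    intro n x hn
    obtain ⟨t, rfl⟩ := hj.exists_mapCube_eq hn x
    exact congrArg (fun q : T ⟶ B => mapCube q n t) h
  intro n
  induction n with
  | zero => exact fun x => hlow 0 x zero_le_one
  | succ n ih =>
    cases n with
    | zero => exact fun x => hlow 1 x le_rfl
    | succ n =>
      intro x
      refine hB n _ _ fun k i => ?_
      rw [← mapCube_face, ← mapCube_face]
      exact ih _

/-- HDAs with the same `1`-skeleton in which shells have a unique filler are isomorphic. -/
theorem HM1.nonempty_iso {r : Sig → Sig → Prop} {j : T ⟶ A} {j' : T ⟶ B} (hj : HM1 j)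
    (hj' : HM1 j') (hA2 : A.HM2 r) (hA3 : A.HM3) (hA : A.FillsShells r) (hB2 : B.HM2 r)
    (hB3 : B.HM3) (hB : B.FillsShells r) : Nonempty (A ≅ B) := by
  obtain ⟨f, hf⟩ := hj.exists_extension j' hA2 hB3 hB
  obtain ⟨g, hg⟩ := hj'.exists_extension j hB2 hA3 hA
  exact ⟨f, g, hj.hom_ext hA3 (by rw [← Category.assoc, hf, hg, Category.comp_id]),
    hj'.hom_ext hB3 (by rw [← Category.assoc, hg, hf, Category.comp_id])⟩

end Extension

end HDA

/-! ### Signs of faces of permutations, and the model properties of the free symmetric HDA. -/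

/-- The cycle `i.cycleRange`, of sign `(-1)^i`, moves `i` to `0` and keeps the order of the other
elements. Moving both the deleted argument and the deleted value to `0` in this way turns `θ` into
the permutation that fixes `0` and acts as `permFace i θ` on the rest. -/
theorem sign_permFace {n : ℕ} (i : Fin (n + 1)) (θ : Equiv.Perm (Fin (n + 1))) :
    Equiv.Perm.sign (permFace i θ) =
      Equiv.Perm.sign θ * ((-1) ^ (i : ℕ) * (-1) ^ (θ.symm i : ℕ)) := by
  have h : Equiv.Perm.decomposeFin.symm (0, permFace i θ) * (θ.symm i).cycleRange =
      i.cycleRange * θ := by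
    ext j : 1
    rcases Fin.eq_self_or_eq_succAbove (θ.symm i) j with rfl | ⟨m, rfl⟩
    · simp
    · rw [Equiv.Perm.mul_apply, Equiv.Perm.mul_apply, Fin.cycleRange_succAbove,
        ← succAbove_permFace, Fin.cycleRange_succAbove]
      simp
  have h' := congrArg Equiv.Perm.sign h
  rw [map_mul, map_mul, Fin.sign_cycleRange, Fin.sign_cycleRange,
    Equiv.Perm.decomposeFin.symm_sign, if_pos rfl, one_mul] at h'
  rw [← mul_assoc, mul_comm (Equiv.Perm.sign θ), ← h', mul_assoc, Int.units_mul_self, mul_one]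

namespace HDA

variable {Sig : Type v}

section Free

/-- The permutation component of a cube of the free symmetric HDA. -/
def freePerm {Q : HDA.{u} Sig} {n : ℕ} (y : Q.freeSymmetric.cube n) : Equiv.Perm (Fin n) := y.1

/-- The underlying cube of a cube of the free symmetric HDA. -/
def freeBase {Q : HDA.{u} Sig} {n : ℕ} (y : Q.freeSymmetric.cube n) : Q.cube n := y.2

theorem freePerm_face {Q : HDA.{u} Sig} {n : ℕ} (k : Fin 2) (i : Fin (n + 1))
    (y : Q.freeSymmetric.cube (n + 1)) :
    freePerm (Q.freeSymmetric.face k i y) = permFace i (freePerm y) := rfl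

theorem freeBase_face {Q : HDA.{u} Sig} {n : ℕ} (k : Fin 2) (i : Fin (n + 1))
    (y : Q.freeSymmetric.cube (n + 1)) :
    freeBase (Q.freeSymmetric.face k i y) = Q.face k ((freePerm y).symm i) (freeBase y) := rfl

theorem free_ext {Q : HDA.{u} Sig} {n : ℕ} {y z : Q.freeSymmetric.cube n}
    (h₁ : freePerm y = freePerm z) (h₂ : freeBase y = freeBase z) : y = z :=
  Prod.ext h₁ h₂

/-- A face in a direction other than `i` retains the label in question, and
`succAbove_permFace_symm` tracks its position; the induction ends at edges. -/
theorem edgeLabels_freeSymmetric (Q : HDA.{u} Sig) {n : ℕ} (y : Q.freeSymmetric.cube n)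
    (i : Fin n) : Q.freeSymmetric.edgeLabels y i =
      Q.edgeLabels (freeBase y) ((freePerm y).symm i) := by
  induction n with
  | zero => exact i.elim0
  | succ n ih =>
    cases n with
    | zero =>
      exact congrArg (Q.edgeLabels (freeBase y))
        (Subsingleton.elim (α := Fin 1) i ((freePerm y).symm i))
    | succ n =>
      obtain ⟨a, ha⟩ := exists_ne i
      obtain ⟨m, rfl⟩ := Fin.exists_succAbove_eq ha.symm
      rw [← edgeLabels_face _ 0, ih, freeBase_face, freePerm_face, edgeLabels_face,
        succAbove_permFace_symm]

/-- The inclusion of an HDA in the free symmetric HDA it generates. -/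
def toFreeSymmetric (Q : HDA.{u} Sig) : Q ⟶ Q.freeSymmetric.toHDA :=
  show HDA.Hom _ _ from
  { app := fun _ x => (1, x)
    app_face := fun _ i _ => Prod.ext (permFace_one i).symm rfl
    app_init := rfl
    app_final := fun _ hx => ⟨Set.mem_univ _, hx⟩
    label_app := fun _ => rfl }

theorem isSubHDA_toFreeSymmetric (Q : HDA.{u} Sig) : IsSubHDA Q.toFreeSymmetric where
  injective _ _ _ h := congrArg Prod.snd h
  final_iff _ := ⟨fun h => h.2, fun h => ⟨Set.mem_univ _, h⟩⟩

/-- In degrees 0 and 1 the identity is the only permutation, so `Q` and `SQ` have the same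
1-skeleton. -/
theorem HM1.comp_toFreeSymmetric {T Q : HDA.{u} Sig} {j : T ⟶ Q} (hj : HM1 j) :
    HM1 (j ≫ Q.toFreeSymmetric) where
  isSubHDA := hj.isSubHDA.comp Q.isSubHDA_toFreeSymmetric
  range_eq n := by
    ext ⟨θ, x⟩
    constructor
    · rintro ⟨t, -⟩
      exact (hj.range_eq n).subset ⟨t, rfl⟩
    · intro (hn : n ≤ 1)
      obtain ⟨t, rfl⟩ := hj.exists_mapCube_eq hn x
      refine ⟨t, Prod.ext ?_ rfl⟩
      have : Subsingleton (Fin n) := Fin.subsingleton_iff_le_one.2 hn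
      exact Subsingleton.elim (α := Equiv.Perm (Fin n)) _ _

/-- A permutation either keeps or exchanges the two starting edges of a 2-cube, hence the symmetric
closure. -/
theorem HM2.freeSymmetric {Q : HDA.{u} Sig} {r : Sig → Sig → Prop} (hQ : Q.HM2 r) :
    Q.freeSymmetric.toHDA.HM2 (Relation.SymmGen r) := by
  intro y
  have hlt := fun i j => hQ.edgeLabels (freeBase y) (i := i) (j := j)
  rw [← edgeLabels_one _ _ 0, ← edgeLabels_one _ _ 0, edgeLabels_face, edgeLabels_face,
    edgeLabels_freeSymmetric, edgeLabels_freeSymmetric]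
  rcases lt_or_gt_of_ne ((freePerm y).symm.injective.ne (show (1 : Fin 2).succAbove 0 ≠
    (0 : Fin 2).succAbove 0 by decide)) with h | h
  · exact .of_rel (hlt _ _ h)
  · exact .of_rel_symm (hlt _ _ h)

variable {Q : HDA.{u} Sig} {r : Sig → Sig → Prop}

theorem HM2.strictMono_edgeLabels [LinearOrder Sig] (hr : ∀ a b, r a b → a < b) (hQ : Q.HM2 r)
    {n : ℕ} (x : Q.cube n) : StrictMono (Q.edgeLabels x) :=
  fun _ _ h => hr _ _ (hQ.edgeLabels x h)

/-- The permutation component of a cube of the free symmetric HDA is the one that sorts its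
labels. -/
theorem HM2.strictMono_edgeLabels_freeSymmetric [LinearOrder Sig] (hr : ∀ a b, r a b → a < b)
    (hQ : Q.HM2 r) {n : ℕ} (y : Q.freeSymmetric.cube n) :
    StrictMono (Q.freeSymmetric.toHDA.edgeLabels y ∘ freePerm y) := by
  intro i j hij
  simp only [Function.comp_apply, edgeLabels_freeSymmetric, Equiv.symm_apply_apply]
  exact hQ.strictMono_edgeLabels hr (freeBase y) hij

/-- The boundary determines the labels, the labels determine the sorting permutation, and once this
is known the boundary of the underlying cube can be recovered. -/
theorem HM3.freeSymmetric (hr : IsAcyclicRelation r) (hQ2 : Q.HM2 r) (hQ : Q.HM3) :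
    Q.freeSymmetric.toHDA.HM3 := by
  obtain ⟨_, hr⟩ := hr.exists_linearOrder
  intro n y y' h
  have hlab : Q.freeSymmetric.toHDA.edgeLabels y = Q.freeSymmetric.toHDA.edgeLabels y' := by
    funext i
    obtain ⟨a, ha⟩ := exists_ne i
    obtain ⟨m, rfl⟩ := Fin.exists_succAbove_eq ha.symm
    rw [← edgeLabels_face _ 0, ← edgeLabels_face _ 0, h]
  have h1 := hQ2.strictMono_edgeLabels_freeSymmetric hr y
  rw [hlab] at h1
  have hθ : freePerm y = freePerm y' :=
    Equiv.Perm.eq_of_strictMono_comp h1 (hQ2.strictMono_edgeLabels_freeSymmetric hr y')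
  refine free_ext hθ (hQ n _ _ fun k i => ?_)
  -- The face of `(θ, x)` in direction `θ i` lies over the face of `x` in direction `i`.
  have := congrArg freeBase (h k (freePerm y i))
  rwa [freeBase_face, freeBase_face, ← hθ, Equiv.symm_apply_apply] at this

/-- Let `θ` sort the labels `b` of the shell. The permutation of `s k i` sorts the labels other than
`b i`, and so does `permFace i θ`; hence they coincide. The underlying cubes, reindexed by `θ`, form
a shell in `Q`, and a filler `x` of it yields the filler `(θ, x)`. -/
theorem FillsShells.freeSymmetric (hr : IsAcyclicRelation r) (hQ2 : Q.HM2 r)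
    (hQ : Q.FillsShells r) : Q.freeSymmetric.toHDA.FillsShells (Relation.SymmGen r) := by
  obtain ⟨_, hr⟩ := hr.exists_linearOrder
  intro n s b hs
  have hne : ∀ i j, i ≠ j → Relation.SymmGen r (b i) (b j) := fun i j hij => by
    rcases lt_or_gt_of_ne hij with h | h
    · exact hs.rel i j h
    · exact (hs.rel j i h).symm
  have hb : Function.Injective b := by
    intro i j hij
    by_contra h
    rcases hne i j h with h | h
    · exact (hr _ _ h).ne hij
    · exact (hr _ _ h).ne hij.symm
  set θ : Equiv.Perm (Fin (n + 2)) := Tuple.sort b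
  have hθ : StrictMono (b ∘ θ) :=
    (Tuple.monotone_sort b).strictMono_of_injective (hb.comp θ.injective)
  have hperm : ∀ k i, freePerm (s k i) = permFace i θ := by
    intro k i
    have hlab : Q.freeSymmetric.toHDA.edgeLabels (s k i) = b ∘ i.succAbove :=
      funext (hs.edgeLabels k i)
    refine Equiv.Perm.eq_of_strictMono_comp (b := b ∘ i.succAbove) ?_ ?_
    · rw [← hlab]
      exact hQ2.strictMono_edgeLabels_freeSymmetric hr (s k i)
    · intro l m hlm
      simp only [Function.comp_apply, succAbove_permFace]
      exact hθ (Fin.succAbove_lt_succAbove_iff.2 hlm)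
  have hshell : Q.IsShell r (fun k m => freeBase (s k (θ m))) (b ∘ θ) :=
    { face_face := fun k l i j => by
        have h := congrArg freeBase (hs.face_face k l (permFace (θ j) θ i) (θ j))
        rw [freeBase_face, freeBase_face, hperm, hperm, Equiv.symm_apply_apply,
          ← predAbove_permFace_symm, Equiv.symm_apply_apply, Equiv.symm_apply_apply,
          succAbove_permFace, Equiv.symm_apply_apply] at h
        exact h
      edgeLabels := fun k i j => by
        have h := hs.edgeLabels k (θ i) (permFace (θ i) θ j)
        rwa [edgeLabels_freeSymmetric, hperm, Equiv.symm_apply_apply, succAbove_permFace,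
          Equiv.symm_apply_apply] at h
      rel := fun i j hij => by
        -- The labels are related in one direction or the other, and sortedness excludes the wrong
        -- one.
        rcases hne _ _ (θ.injective.ne hij.ne) with h | h
        · exact h
        · exact absurd (hr _ _ h) (hθ hij).not_gt }
  obtain ⟨x, hx⟩ := hQ n _ _ hshell
  refine ⟨(θ, x), fun k i => free_ext (hperm k i).symm ?_⟩
  change Q.face k (θ.symm i) x = _
  rw [hx, Equiv.apply_symm_apply]

end Free

/-! ### Homology languages of an HDA and of its free symmetric HDA. -/

section HomologyLanguage

variable (R : Type w) [CommRing R]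

theorem mem_homologyLanguage {Q : HDA.{u} Sig} {n : ℕ} {y : ⋀[R]^n (Sig →₀ R)} :
    y ∈ Q.homologyLanguage R n ↔
      ∃ c ∈ Q.toPrecubicalSet.cycles R n, Q.labelling R n c = y := by
  constructor
  · rintro ⟨z, rfl⟩
    obtain ⟨c, rfl⟩ := Submodule.mkQ_surjective _ z
    exact ⟨c, c.2, rfl⟩
  · rintro ⟨c, hc, rfl⟩
    exact ⟨(Q.toPrecubicalSet.boundaries R n).mkQ ⟨c, hc⟩, rfl⟩

/-- A chain map compatible with the labellings induces an inclusion of homology languages. -/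
theorem homologyLanguage_le {A B : HDA.{u} Sig}
    (φ : ∀ n, A.toPrecubicalSet.Chains R n →ₗ[R] B.toPrecubicalSet.Chains R n)
    (hφ : ∀ n x, B.toPrecubicalSet.boundary R n (φ (n + 1) (Finsupp.single x 1)) =
      φ n (A.toPrecubicalSet.boundary R n (Finsupp.single x 1)))
    (hl : ∀ n x, B.labelling R n (φ n (Finsupp.single x 1)) =
      A.labelling R n (Finsupp.single x 1)) (n : ℕ) :
    A.homologyLanguage R n ≤ B.homologyLanguage R n := by
  have hφ' : ∀ n, B.toPrecubicalSet.boundary R n ∘ₗ φ (n + 1) =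
      φ n ∘ₗ A.toPrecubicalSet.boundary R n := fun n => by
    ext1 x
    exact LinearMap.ext_ring (hφ n x)
  have hl' : B.labelling R n ∘ₗ φ n = A.labelling R n := by
    ext1 x
    exact LinearMap.ext_ring (hl n x)
  intro y hy
  obtain ⟨c, hc, rfl⟩ := (mem_homologyLanguage R).1 hy
  refine (mem_homologyLanguage R).2 ⟨φ n c, ?_, LinearMap.congr_fun hl' c⟩
  cases n with
  | zero => exact Submodule.mem_top
  | succ n =>
    have h := LinearMap.congr_fun (hφ' n) c
    change A.toPrecubicalSet.boundary R n c = 0 at hc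
    change B.toPrecubicalSet.boundary R n (φ (n + 1) c) = 0
    exact h.trans ((congrArg (φ n) hc).trans (map_zero _))

theorem labelling_single (Q : HDA.{u} Sig) {n : ℕ} (x : Q.cube n) :
    Q.labelling R n (Finsupp.single x 1) =
      exteriorPower.ιMulti R n fun i => Finsupp.single (Q.edgeLabels x i) (1 : R) := by
  rw [labelling, Finsupp.linearCombination_single, one_smul]

theorem homologyLanguage_mono {A B : HDA.{u} Sig} (f : A ⟶ B) (n : ℕ) :
    A.homologyLanguage R n ≤ B.homologyLanguage R n := by
  refine homologyLanguage_le R (fun n => Finsupp.lmapDomain R R (mapCube f n)) ?_ ?_ n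
  · intro n x
    simp only [Finsupp.lmapDomain_apply, Finsupp.mapDomain_single,
      PrecubicalSet.boundary_single, map_sum, map_smul, map_sub]
    simp only [mapCube_face]
  · intro n x
    rw [Finsupp.lmapDomain_apply, Finsupp.mapDomain_single, labelling_single, labelling_single,
      edgeLabels_mapCube]

/-- The chain map from the free symmetric HDA given by `(θ, x) ↦ sign θ • x`. -/
noncomputable def signedProjection (Q : HDA.{u} Sig) (n : ℕ) :
    Q.freeSymmetric.toPrecubicalSet.Chains R n →ₗ[R] Q.toPrecubicalSet.Chains R n :=
  Finsupp.linearCombination R fun y =>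
    ((Equiv.Perm.sign (freePerm y) : ℤ) : R) • Finsupp.single (freeBase y) (1 : R)

theorem signedProjection_single (Q : HDA.{u} Sig) {n : ℕ} (y : Q.freeSymmetric.cube n) :
    Q.signedProjection R n (Finsupp.single y 1) =
      ((Equiv.Perm.sign (freePerm y) : ℤ) : R) • Finsupp.single (freeBase y) (1 : R) := by
  rw [signedProjection, Finsupp.linearCombination_single, one_smul]

/-- The `i`-th face of `(θ, x)` lies over the face of `x` in direction `θ⁻¹ i`, and `sign_permFace`
says that `sign (permFace i θ) * (-1)^i = sign θ * (-1)^(θ⁻¹ i)`. So the two sums agree term by term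
after reindexing by `θ⁻¹`. -/
theorem boundary_signedProjection (Q : HDA.{u} Sig) {n : ℕ} (y : Q.freeSymmetric.cube (n + 1)) :
    Q.toPrecubicalSet.boundary R n (Q.signedProjection R (n + 1) (Finsupp.single y 1)) =
      Q.signedProjection R n
        (Q.freeSymmetric.toPrecubicalSet.boundary R n (Finsupp.single y 1)) := by
  rw [signedProjection_single, map_smul, PrecubicalSet.boundary_single,
    PrecubicalSet.boundary_single]
  simp only [map_sum, map_smul, map_sub, signedProjection_single]
  rw [Finset.smul_sum, ← Equiv.sum_comp (freePerm y).symm]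
  refine Finset.sum_congr rfl fun i _ => ?_
  rw [freePerm_face, freePerm_face, freeBase_face, freeBase_face]
  rw [← smul_sub, smul_smul, smul_smul, sign_permFace]
  congr 1
  push_cast
  have h : (-1 : R) ^ (i : ℕ) * (-1) ^ (i : ℕ) = 1 := by
    rw [← mul_pow, neg_one_mul, neg_neg, one_pow]
  linear_combination (-((Equiv.Perm.sign (freePerm y) : ℤ) : R) * (-1) ^ ((freePerm y).symm i : ℕ) * (-1)) * h

/-- The labels of `(θ, x)` are those of `x` permuted by `θ⁻¹`, which multiplies their wedge product
by `sign θ`. -/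
theorem labelling_signedProjection (Q : HDA.{u} Sig) {n : ℕ} (y : Q.freeSymmetric.cube n) :
    Q.labelling R n (Q.signedProjection R n (Finsupp.single y 1)) =
      Q.freeSymmetric.toHDA.labelling R n (Finsupp.single y 1) := by
  rw [signedProjection_single, map_smul, labelling_single, labelling_single]
  simp only [edgeLabels_freeSymmetric]
  have h := (exteriorPower.ιMulti R n).map_perm
    (fun i => Finsupp.single (Q.edgeLabels (freeBase y) i) (1 : R)) (freePerm y).symm
  refine Eq.trans ?_ h.symm
  rw [Equiv.Perm.sign_symm]
  rcases Int.units_eq_one_or (Equiv.Perm.sign (freePerm y)) with hs | hs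
  · simp [hs]
  · simp only [hs, Units.val_neg, Units.val_one, Int.cast_neg, Int.cast_one, Units.neg_smul,
      one_smul]
    exact neg_one_smul R (M := ⋀[R]^n (Sig →₀ R)) _

theorem homologyLanguage_freeSymmetric (Q : HDA.{u} Sig) (n : ℕ) :
    Q.freeSymmetric.toHDA.homologyLanguage R n = Q.homologyLanguage R n :=
  le_antisymm
    (homologyLanguage_le R (A := Q.freeSymmetric.toHDA) (Q.signedProjection R)
      (fun _ => Q.boundary_signedProjection R) (fun _ => Q.labelling_signedProjection R) n)
    (homologyLanguage_mono R Q.toFreeSymmetric n)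

end HomologyLanguage

end HDA

/-! ### The main theorem. -/

theorem theorem3p1 {Sig : Type v} (R : Type w) [CommRing R] [IsDomain R] [IsPrincipalIdealRing R]
    (T : HDA.{u} Sig) (hT : T.IsTransitionSystem)
    (I ltimes : Sig → Sig → Prop) (hI : IsIndependenceRelation I) (hltimes : IsAcyclicRelation ltimes)
    (hsymm : I = Relation.SymmGen ltimes)
    (A Q : HDA.{u} Sig) (hA : A.IsModelOf T I) (hQ : Q.IsModelOf T ltimes) :
    Nonempty (A ≅ Q.freeSymmetric.toHDA) ∧
      A.homologyLanguage R = Q.homologyLanguage R := by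
  subst hsymm
  -- Maximality (HM4) enters only through shell filling.
  have hAfill := hA.fillsShells
  have hQfill := hQ.fillsShells
  obtain ⟨j, hj, hA2, hA3, -⟩ := hA
  obtain ⟨j', hj', hQ2, hQ3, -⟩ := hQ
  obtain ⟨e⟩ := hj.nonempty_iso hj'.comp_toFreeSymmetric hA2 hA3 hAfill hQ2.freeSymmetric
    (hQ3.freeSymmetric hltimes hQ2) (hQfill.freeSymmetric hltimes hQ2)
  refine ⟨⟨e⟩, funext fun n => ?_⟩
  rw [← HDA.homologyLanguage_freeSymmetric R Q]
  exact le_antisymm (HDA.homologyLanguage_mono R e.hom n) (HDA.homologyLanguage_mono R e.inv n)
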